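/- For $N\in\mathbb N$ and $\mathbf x=(x_1,x_2)\in\mathbb R^2$ let $$S_2(\mathbf x;N)=\sum_{n=1}^N e(x_1 n+x_2 n^2),\qquad e(z)=\exp(2\pi i z),$$ and for real $s>0$ and $0<\delta\le 1$ put $$I^{\sharp}_{s,2}(\delta;N)=\sup_{\boldsymbol\xi\in[0,1)^2}\int_{\boldsymbol\xi+[0,\delta]^2}|S_2(\mathbf x;N)|^{2s}\,d\mathbf x .$$ Then for every real $s>0$ and every $\varepsilon>0$ there is an integer $N_0=N_0(s,\varepsilon)$ such that for all integers $N\ge N_0$ and all real $\delta$ with $N^{-3/(6+2s)}\le\delta\le 1$, $$I^{\sharp}_{s,2}(\delta;N)\le \delta^2 N^{2s\left(1-\frac{3}{6+2s}\right)+\varepsilon}.$$ In other words, $I^{\sharp}_{s,2}(\delta;N)\le \delta^2N^{2s(1-3/(6+2s))+o(1)}$ as $N\to\infty$ for each fixed $s>0$, uniformly in $\delta\in[N^{-3/(6+2s)},1]$. -/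

import Mathlib

open MeasureTheory

/-- The weighted Weyl sum `S_d(x; a, N) = ∑_{n=1}^N a_n e(x_1 n + ⋯ + x_d n^d)`, with
`e(z) = exp(2πiz)`. The coordinate `x_{j+1}` is `x j`, `j : Fin d`. -/
noncomputable def weylSum (d : ℕ) (x : Fin d → ℝ) (a : ℕ → ℂ) (N : ℕ) : ℂ :=
  ∑ n ∈ Finset.Icc 1 N,
    a n * Complex.exp (2 * Real.pi * Complex.I *
      ((∑ j : Fin d, x j * (n : ℝ) ^ ((j : ℕ) + 1) : ℝ) : ℂ))

/-- The box `ξ + [0, δ]^d`. -/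
def weylBox (d : ℕ) (δ : ℝ) (ξ : Fin d → ℝ) : Set (Fin d → ℝ) :=
  Set.Icc ξ (fun j => ξ j + δ)

/-- The mean value `I_{s,d}(δ, ξ; a, N) = ∫_{ξ + [0, δ]^d} |S_d(x; a, N)|^{2s} dx`. -/
noncomputable def boxMeanValue (s : ℝ) (d : ℕ) (δ : ℝ) (ξ : Fin d → ℝ) (a : ℕ → ℂ) (N : ℕ) : ℝ :=
  ∫ x in weylBox d δ ξ, ‖weylSum d x a N‖ ^ (2 * s)

/-- The unit cube `[0,1)^d`, identified with the torus `(ℝ/ℤ)^d`. -/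
def unitTorusCube (d : ℕ) : Set (Fin d → ℝ) :=
  {ξ | ∀ j, ξ j ∈ Set.Ico (0 : ℝ) 1}

/-- `I^♯_{s,d}(δ; N)`: the supremum over `ξ ∈ [0,1)^d` of the mean values of the Weyl sum with all
weights equal to `1`. -/
noncomputable def supBoxMeanValue (s : ℝ) (d : ℕ) (δ : ℝ) (N : ℕ) : ℝ :=
  ⨆ ξ : unitTorusCube d, boxMeanValue s d δ ξ 1 N

/-- The Weyl sum is continuous in `x`. -/
theorem continuous_weylSum (d : ℕ) (a : ℕ → ℂ) (N : ℕ) :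
    Continuous fun x => weylSum d x a N := by
  unfold weylSum
  fun_prop

/-- The integrand defining the mean value is integrable on each box. -/
theorem integrableOn_weylBox {s : ℝ} (hs : 0 < s) (d : ℕ) (δ : ℝ) (ξ : Fin d → ℝ) (a : ℕ → ℂ)
    (N : ℕ) : IntegrableOn (fun x => ‖weylSum d x a N‖ ^ (2 * s)) (weylBox d δ ξ) :=
  (((continuous_weylSum d a N).norm.rpow_const fun _ => Or.inr (by positivity)).continuousOn).integrableOn_compact
    isCompact_Icc

/-- The trivial bound for the Weyl sum with all weights equal to `1`. -/
theorem norm_weylSum_one_le (d : ℕ) (x : Fin d → ℝ) (N : ℕ) : ‖weylSum d x 1 N‖ ≤ N := by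
  unfold weylSum
  refine (norm_sum_le _ _).trans ?_
  have h : ∀ t : ℝ, ‖Complex.exp (2 * Real.pi * Complex.I * (t : ℂ))‖ = 1 := by
    intro t
    rw [show (2 * Real.pi * Complex.I * (t : ℂ) : ℂ) = ((2 * Real.pi * t : ℝ) : ℂ) * Complex.I by
      push_cast; ring]
    exact Complex.norm_exp_ofReal_mul_I _
  simp only [Pi.one_apply, one_mul, h]
  simp

/-- The mean values over which the supremum is taken are bounded, so that the supremum is a genuine
least upper bound. -/
theorem bddAbove_boxMeanValue {s : ℝ} (hs : 0 < s) (d : ℕ) {δ : ℝ} (hδ : 0 ≤ δ) (N : ℕ) :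
    BddAbove (Set.range fun ξ : unitTorusCube d => boxMeanValue s d δ ξ 1 N) := by
  refine ⟨δ ^ d * (N : ℝ) ^ (2 * s), ?_⟩
  rintro _ ⟨ξ, rfl⟩
  have hv : volume.real (weylBox d δ (ξ : Fin d → ℝ)) = δ ^ d := by
    rw [weylBox, measureReal_def, Real.volume_Icc_pi_toReal (fun j => by simpa using hδ)]
    simp
  have hfin : volume (weylBox d δ (ξ : Fin d → ℝ)) ≠ ⊤ := isCompact_Icc.measure_lt_top.ne
  calc boxMeanValue s d δ ξ 1 N
      ≤ ∫ _ in weylBox d δ (ξ : Fin d → ℝ), (N : ℝ) ^ (2 * s) := by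
        refine setIntegral_mono (integrableOn_weylBox hs d δ ξ 1 N)
          (integrableOn_const hfin) fun x => ?_
        exact Real.rpow_le_rpow (norm_nonneg _) (norm_weylSum_one_le d x N) (by positivity)
    _ = δ ^ d * (N : ℝ) ^ (2 * s) := by
        rw [setIntegral_const, hv, smul_eq_mul]

/-! Put $T=N^{\theta}$ with $\theta=3/(6+2s)$, and split the box at the level $|S_2|=N/T$. Below it
the integrand is at most $(N/T)^{2s}$. Above it use $|S_2|\le N$ and the measure bound
$\ll\delta^2T^6N^{-3}(1+\log N)^2$ for the large values (`volume_large_values_le`). The two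
contributions balance when $T^{6+2s}=N^3$.

The measure bound rests on expanding $|S_2|^2=\sum_j c_j(x_2)e(jx_1)$. Differencing makes $c_j$ a
geometric sum, so that $|c_j|\le\min(N,1/(2\|2jx_2\|))$, where $\|\cdot\|$ is the distance to the
nearest integer. The sum of all $|c_j|$ bounds $|S_2|^2$, so a large value forces
$|2qx_2-a|\le\eta\approx T^2N^{-2}\log N$ for some $q\le4T^2$ (`exists_approx_of_large`). For each
$q$ these $x_2$ fill measure $\ll\eta(\delta+1/q)$. For such an $x_2$, a Fejér kernel localises the
second moment in $x_1$ to an interval of length $\delta$, and only frequencies $|j|\ll1/\delta$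
survive (`setIntegral_sq_norm_quadSum_le`). Chebyshev's inequality then leaves measure $\ll
T^2N^{-1}\log N\,(\delta+1/q)$ in $x_1$ (`volume_large_section_le`). Multiplying and summing over
$q$ gives $T^4N^{-3}(\log N)^2\sum_{q\le4T^2}(\delta+1/q)^2$. Since $\delta T\ge1$, the sum over $q$
is $\ll\delta^2T^2$. -/

/-! ### Additive characters and geometric sums -/

/-- The additive character `e(t) = exp(2πit)`. -/
noncomputable def expChar (t : ℝ) : ℂ := Complex.exp (2 * Real.pi * Complex.I * (t : ℂ))

theorem expChar_eq (t : ℝ) :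
    expChar t = Complex.exp (Complex.I * ((2 * Real.pi * t : ℝ) : ℂ)) := by
  unfold expChar; congr 1; push_cast; ring

theorem expChar_add (s t : ℝ) : expChar (s + t) = expChar s * expChar t := by
  unfold expChar; rw [← Complex.exp_add]; congr 1; push_cast; ring

theorem norm_expChar (t : ℝ) : ‖expChar t‖ = 1 := by
  rw [expChar_eq, mul_comm]; exact Complex.norm_exp_ofReal_mul_I _

theorem conj_expChar (t : ℝ) : (starRingEnd ℂ) (expChar t) = expChar (-t) := by
  unfold expChar
  rw [← Complex.exp_conj]
  congr 1
  simp [Complex.conj_ofNat]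

theorem expChar_intCast (n : ℤ) : expChar n = 1 := by
  unfold expChar
  rw [Complex.exp_eq_one_iff]
  exact ⟨n, by push_cast; ring⟩

theorem continuous_expChar : Continuous expChar := by
  unfold expChar; fun_prop

theorem re_expChar (t : ℝ) : (expChar t).re = Real.cos (2 * Real.pi * t) := by
  rw [expChar_eq, mul_comm, Complex.exp_ofReal_mul_I_re]

/-- By periodicity $\alpha$ may be reduced to $|\beta|\le1/2$, where Jordan's inequality gives
$2|\sin\pi\beta|\ge4|\beta|$. -/
theorem four_mul_abs_sub_round_le (α : ℝ) : 4 * |α - round α| ≤ ‖expChar α - 1‖ := by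
  have h1 : expChar α = expChar (α - round α) := by
    conv_lhs => rw [show α = (α - round α) + ((round α : ℤ) : ℝ) by ring]
    rw [expChar_add, expChar_intCast, mul_one]
  rw [h1, expChar_eq, Complex.norm_exp_I_mul_ofReal_sub_one, Real.norm_eq_abs, abs_mul]
  have h2 := abs_sub_round α
  set β := α - round α
  have h3 : |2 * Real.pi * β / 2| ≤ Real.pi / 2 := by
    rw [show 2 * Real.pi * β / 2 = Real.pi * β by ring, abs_mul, abs_of_pos Real.pi_pos]
    nlinarith [Real.pi_pos]
  have h4 := Real.mul_abs_le_abs_sin h3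
  rw [show 2 * Real.pi * β / 2 = Real.pi * β by ring, abs_mul, abs_of_pos Real.pi_pos] at h4
  rw [show 2 * Real.pi * β / 2 = Real.pi * β by ring]
  have : 2 / Real.pi * (Real.pi * |β|) = 2 * |β| := by field_simp
  rw [this] at h4
  norm_num
  linarith

theorem expChar_sub_one_mul_sum (α : ℝ) (a b : ℤ) (hab : a ≤ b) :
    (expChar α - 1) * ∑ m ∈ Finset.Ico a b, expChar (m * α) =
      expChar (b * α) - expChar (a * α) := by
  induction b, hab using Int.leInduction with
  | base => simp
  | succ b hb ih =>
    rw [← Finset.insert_Ico_right_eq_Ico_add_one hb, Finset.sum_insert (by simp), mul_add, ih,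
      show ((b + 1 : ℤ) : ℝ) * α = α + b * α by push_cast; ring, expChar_add]
    ring

/-- The product form of the geometric sum bound stays meaningful when $\alpha$ is an integer. -/
theorem norm_sum_Ico_expChar_mul_le (α : ℝ) (a b : ℤ) :
    ‖∑ m ∈ Finset.Ico a b, expChar (m * α)‖ * |α - round α| ≤ 1 / 2 := by
  rcases le_total a b with hab | hab
  · have h := congrArg norm (expChar_sub_one_mul_sum α a b hab)
    rw [norm_mul] at h
    have h2 : ‖expChar (b * α) - expChar (a * α)‖ ≤ 2 := by
      refine (norm_sub_le _ _).trans ?_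
      rw [norm_expChar, norm_expChar]; norm_num
    have h3 := mul_le_mul_of_nonneg_right (four_mul_abs_sub_round_le α)
      (norm_nonneg (∑ m ∈ Finset.Ico a b, expChar (m * α)))
    linarith
  · rw [Finset.Ico_eq_empty (by simpa using hab)]; simp

/-! ### Fourier coefficients of the squared Weyl sum -/

/-- The quadratic Weyl sum, indexed by integers. -/
noncomputable def quadSum (N : ℕ) (x y : ℝ) : ℂ :=
  ∑ n ∈ Finset.Icc (1 : ℤ) N, expChar (x * n + y * (n : ℝ) ^ 2)

theorem weylSum_two_eq_quadSum (N : ℕ) (x : Fin 2 → ℝ) :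
    weylSum 2 x 1 N = quadSum N (x 0) (x 1) := by
  unfold weylSum quadSum
  refine Finset.sum_nbij' (fun n : ℕ => (n : ℤ)) (fun n : ℤ => n.toNat) ?_ ?_ ?_ ?_ ?_
  · intro n hn; simp at hn ⊢; omega
  · intro n hn; simp at hn ⊢; omega
  · intro n hn; simp
  · intro n hn; simp at hn ⊢; omega
  · intro n hn
    simp [expChar, Fin.sum_univ_two]

/-- The Fourier coefficient of `x ↦ |quadSum N x y|²` at `j`. -/
noncomputable def autoCorr (N : ℕ) (y : ℝ) (j : ℤ) : ℂ :=
  ∑ p ∈ (Finset.Icc (1 : ℤ) N ×ˢ Finset.Icc (1 : ℤ) N) with p.1 - p.2 = j,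
    expChar (y * ((p.1 : ℝ) ^ 2 - (p.2 : ℝ) ^ 2))

/-- Weyl differencing: $(m+j)^2-m^2=2mj+j^2$ is linear in $m$. The range of $m$ is where both $m$
and $m+j$ lie in $[1,N]$. -/
theorem autoCorr_eq (N : ℕ) (y : ℝ) (j : ℤ) :
    autoCorr N y j = expChar (y * j ^ 2) *
      ∑ m ∈ Finset.Ico (max 1 (1 - j)) (min (N + 1) (N + 1 - j)), expChar (m * (j * (2 * y))) := by
  unfold autoCorr
  rw [Finset.mul_sum]
  refine Finset.sum_nbij' (fun p => p.2) (fun m => (m + j, m)) ?_ ?_ ?_ ?_ ?_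
  · intro p hp; simp at hp ⊢; omega
  · intro m hm; simp at hm ⊢; omega
  · rintro ⟨a, b⟩ hp; simp at hp ⊢; omega
  · intro m hm; simp
  · rintro ⟨a, b⟩ hp
    simp at hp
    obtain rfl : a = b + j := by omega
    rw [← expChar_add]
    congr 1
    push_cast; ring

theorem norm_autoCorr_le (N : ℕ) (y : ℝ) (j : ℤ) : ‖autoCorr N y j‖ ≤ N := by
  rw [autoCorr_eq, norm_mul, norm_expChar, one_mul]
  refine (norm_sum_le _ _).trans ?_
  simp only [norm_expChar, Finset.sum_const, Int.card_Ico, nsmul_eq_mul, mul_one]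
  exact_mod_cast (by omega :
    (min ((N : ℤ) + 1) (N + 1 - j) - max 1 (1 - j)).toNat ≤ N)

theorem norm_autoCorr_mul_le (N : ℕ) (y : ℝ) (j : ℤ) :
    ‖autoCorr N y j‖ * |j * (2 * y) - round (j * (2 * y))| ≤ 1 / 2 := by
  rw [autoCorr_eq, norm_mul, norm_expChar, one_mul]
  exact norm_sum_Ico_expChar_mul_le _ _ _

theorem normSq_quadSum (N : ℕ) (x y : ℝ) :
    ((‖quadSum N x y‖ ^ 2 : ℝ) : ℂ) =
      ∑ j ∈ Finset.Icc (-(N : ℤ)) N, autoCorr N y j * expChar (x * j) := by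
  rw [Complex.ofReal_pow, ← Complex.mul_conj', quadSum, map_sum, Finset.sum_mul_sum,
    ← Finset.sum_product',
    ← Finset.sum_fiberwise_of_maps_to (t := Finset.Icc (-(N : ℤ)) N) (g := fun p => p.1 - p.2)]
  · refine Finset.sum_congr rfl fun j _ => ?_
    rw [autoCorr, Finset.sum_mul]
    refine Finset.sum_congr rfl fun p hp => ?_
    obtain rfl := (Finset.mem_filter.1 hp).2
    rw [conj_expChar, ← expChar_add, ← expChar_add]
    congr 1
    push_cast; ring
  · intro p hp; simp at hp ⊢; omega

/-- The sum of the absolute values of the Fourier coefficients with frequency at most `H`. -/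
noncomputable def autoCorrSum (N : ℕ) (y : ℝ) (H : ℕ) : ℝ :=
  ∑ j ∈ Finset.Icc (-(H : ℤ)) H, ‖autoCorr N y j‖

theorem sq_norm_quadSum_le (N : ℕ) (x y : ℝ) : ‖quadSum N x y‖ ^ 2 ≤ autoCorrSum N y N := by
  have h := congrArg norm (normSq_quadSum N x y)
  rw [Complex.norm_real, Real.norm_of_nonneg (by positivity)] at h
  rw [h]
  refine (norm_sum_le _ _).trans (le_of_eq ?_)
  simp [autoCorrSum, norm_expChar]

/-! ### Localised second moment in the linear variable -/

theorem integral_expChar_mul_int (ξ : ℝ) (j : ℤ) :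
    ∫ x in ξ..ξ + 1, expChar (x * j) = if j = 0 then 1 else 0 := by
  split_ifs with h
  · subst h; simp [expChar]
  · have hc : (2 * Real.pi * Complex.I * j : ℂ) ≠ 0 := by
      simp [Real.pi_ne_zero, h]
    have h1 : ∀ x : ℝ, expChar (x * j) = Complex.exp (2 * Real.pi * Complex.I * j * x) := by
      intro x; unfold expChar; congr 1; push_cast; ring
    have h2 : expChar ((ξ + 1) * j) = expChar (ξ * j) := by
      rw [add_mul, one_mul, expChar_add, expChar_intCast, mul_one]
    simp only [h1, integral_exp_mul_complex hc]
    rw [← h1, ← h1, h2, sub_self, zero_div]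

theorem continuous_quadSum (N : ℕ) (y : ℝ) : Continuous fun x => quadSum N x y := by
  unfold quadSum
  have := continuous_expChar
  fun_prop

theorem integral_expChar_mul_normSq (N : ℕ) (ξ y : ℝ) (k : ℤ) :
    ‖∫ x in ξ..ξ + 1, expChar (x * k) * ((‖quadSum N x y‖ ^ 2 : ℝ) : ℂ)‖ ≤
      ‖autoCorr N y (-k)‖ := by
  have hc := continuous_expChar
  have h1 : ∀ x : ℝ, expChar (x * k) * ((‖quadSum N x y‖ ^ 2 : ℝ) : ℂ) =
      ∑ j ∈ Finset.Icc (-(N : ℤ)) N, autoCorr N y j * expChar (x * (j + k : ℤ)) := by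
    intro x
    rw [normSq_quadSum, Finset.mul_sum]
    refine Finset.sum_congr rfl fun j _ => ?_
    rw [show x * ((j + k : ℤ) : ℝ) = x * j + x * k by push_cast; ring, expChar_add]
    ring
  simp only [h1]
  rw [intervalIntegral.integral_finsetSum
    (fun j _ => Continuous.intervalIntegrable (by fun_prop) _ _)]
  simp only [intervalIntegral.integral_const_mul, integral_expChar_mul_int]
  have h2 : ∀ j : ℤ, autoCorr N y j * (if j + k = 0 then (1 : ℂ) else 0) =
      if j = -k then autoCorr N y (-k) else 0 := by
    intro j
    by_cases h : j = -k
    · subst h; simp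
    · rw [if_neg h, if_neg (by omega), mul_zero]
  simp only [h2, Finset.sum_ite_eq']
  split_ifs <;> simp

/-- Every phase has angle at most $\pi/3$, hence real part at least $1/2$. -/
theorem half_le_norm_sum_expChar (K : ℕ) (u : ℝ) (hu : ∀ k < K, (k : ℝ) * |u| ≤ 1 / 6) :
    (K : ℝ) / 2 ≤ ‖∑ k ∈ Finset.range K, expChar (u * k)‖ := by
  refine le_trans ?_ (Complex.re_le_norm _)
  rw [Complex.re_sum]
  have : ∀ k ∈ Finset.range K, (1 / 2 : ℝ) ≤ (expChar (u * k)).re := by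
    intro k hk
    rw [re_expChar, ← Real.cos_abs, ← Real.cos_pi_div_three]
    have h := hu k (Finset.mem_range.1 hk)
    have h2 : |2 * Real.pi * (u * k)| = 2 * Real.pi * (k * |u|) := by
      rw [abs_mul, abs_mul u, abs_of_pos (by positivity), Nat.abs_cast]; ring
    apply Real.cos_le_cos_of_nonneg_of_le_pi (abs_nonneg _)
    · linarith [Real.pi_pos]
    · rw [h2]; nlinarith [Real.pi_pos]
  have h2 := Finset.sum_le_sum this
  simp at h2
  linarith

/-- After the kernel is expanded, the pair $(k,l)$ picks out the coefficient at $l-k$. The centre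
$c$ enters only through unimodular factors, and each of the $K$ rows meets each frequency at most
once. -/
theorem integral_fejer_mul_le (N K : ℕ) (hK : 0 < K) (ξ c y : ℝ) :
    ∫ x in ξ..ξ + 1, ‖∑ k ∈ Finset.range K, expChar ((x - c) * k)‖ ^ 2 * ‖quadSum N x y‖ ^ 2 ≤
      K * autoCorrSum N y (K - 1) := by
  have hc := continuous_expChar
  have hq := continuous_quadSum N y
  set I := ∫ x in ξ..ξ + 1,
    ‖∑ k ∈ Finset.range K, expChar ((x - c) * k)‖ ^ 2 * ‖quadSum N x y‖ ^ 2
  have h1 : (I : ℂ) = ∑ k ∈ Finset.range K, ∑ l ∈ Finset.range K,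
      expChar (-c * ((k : ℤ) - (l : ℤ) : ℤ)) * ∫ x in ξ..ξ + 1,
        expChar (x * ((k : ℤ) - (l : ℤ) : ℤ)) * ((‖quadSum N x y‖ ^ 2 : ℝ) : ℂ) := by
    simp only [I]
    rw [← intervalIntegral.integral_ofReal]
    simp only [← intervalIntegral.integral_const_mul]
    rw [Finset.sum_congr rfl fun k _ => (intervalIntegral.integral_finsetSum
      (fun l _ => Continuous.intervalIntegrable (by fun_prop) _ _)).symm,
      ← intervalIntegral.integral_finsetSum
        (fun l _ => Continuous.intervalIntegrable (by fun_prop) _ _)]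
    congr 1
    ext x
    rw [Complex.ofReal_mul, Complex.ofReal_pow, ← Complex.mul_conj', map_sum, Finset.sum_mul_sum,
      Finset.sum_mul]
    refine Finset.sum_congr rfl fun k _ => ?_
    rw [Finset.sum_mul]
    refine Finset.sum_congr rfl fun l _ => ?_
    rw [conj_expChar, ← expChar_add, ← mul_assoc, ← expChar_add]
    congr 2
    push_cast; ring
  have h2 : I ≤ ‖(I : ℂ)‖ := by rw [Complex.norm_real]; exact le_abs_self _
  refine h2.trans ?_
  rw [h1]
  refine (norm_sum_le _ _).trans ?_
  have h3 : ∀ k ∈ Finset.range K, ‖∑ l ∈ Finset.range K,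
      expChar (-c * ((k : ℤ) - (l : ℤ) : ℤ)) * ∫ x in ξ..ξ + 1,
        expChar (x * ((k : ℤ) - (l : ℤ) : ℤ)) * ((‖quadSum N x y‖ ^ 2 : ℝ) : ℂ)‖ ≤
      autoCorrSum N y (K - 1) := by
    intro k hk
    refine (norm_sum_le _ _).trans ?_
    calc _ ≤ ∑ l ∈ Finset.range K, ‖autoCorr N y (-((k : ℤ) - (l : ℤ)))‖ := by
          refine Finset.sum_le_sum fun l _ => ?_
          rw [norm_mul, norm_expChar, one_mul]
          exact integral_expChar_mul_normSq _ _ _ _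
      _ = ∑ j ∈ (Finset.range K).image (fun l : ℕ => -((k : ℤ) - (l : ℤ))),
            ‖autoCorr N y j‖ := by
          rw [Finset.sum_image]
          intro a _ b _ h
          simp at h
          exact h
      _ ≤ _ := by
          refine Finset.sum_le_sum_of_subset_of_nonneg ?_ fun _ _ _ => norm_nonneg _
          intro j hj
          simp at hj hk ⊢
          omega
  refine (Finset.sum_le_sum h3).trans ?_
  simp

/-- The local second moment of the quadratic Weyl sum in the linear variable. -/
theorem setIntegral_sq_norm_quadSum_le (N : ℕ) (ξ y δ : ℝ) (hδ : 0 < δ) (hδ1 : δ ≤ 1) :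
    ∃ H : ℕ, (H : ℝ) ≤ 1 / (3 * δ) ∧
      ∫ x in Set.Icc ξ (ξ + δ), ‖quadSum N x y‖ ^ 2 ≤ 12 * δ * autoCorrSum N y H := by
  have hc := continuous_expChar
  have hq := continuous_quadSum N y
  -- For $k\le K-1$ and $x$ within $\delta/2$ of the midpoint, $k|x-c|\le1/6$, so the kernel is at
  -- least $K^2/4$ there. Conversely $1/K\le3\delta$, which gives the constant $12$.
  set K := ⌈1 / (3 * δ)⌉₊
  have hK : 0 < K := Nat.ceil_pos.2 (by positivity)
  have hK1 : 1 / (3 * δ) ≤ K := Nat.le_ceil _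
  have hK2 : ((K - 1 : ℕ) : ℝ) ≤ 1 / (3 * δ) := by
    have := Nat.ceil_lt_add_one (a := 1 / (3 * δ)) (by positivity)
    rw [Nat.cast_sub hK]; push_cast; linarith
  refine ⟨K - 1, hK2, ?_⟩
  have hKr : (0 : ℝ) < K := by exact_mod_cast hK
  have h1 := integral_fejer_mul_le N K hK ξ (ξ + δ / 2) y
  have h2 : ∫ x in Set.Icc ξ (ξ + δ), (K : ℝ) ^ 2 / 4 * ‖quadSum N x y‖ ^ 2 ≤
      ∫ x in Set.Icc ξ (ξ + 1), ‖∑ k ∈ Finset.range K, expChar ((x - (ξ + δ / 2)) * k)‖ ^ 2 *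
        ‖quadSum N x y‖ ^ 2 := by
    refine (setIntegral_mono_on (g := fun x => ‖∑ k ∈ Finset.range K,
        expChar ((x - (ξ + δ / 2)) * k)‖ ^ 2 * ‖quadSum N x y‖ ^ 2) ?_ ?_ measurableSet_Icc ?_).trans
      (setIntegral_mono_set ?_ ?_ ?_)
    · exact Continuous.integrableOn_Icc (by fun_prop)
    · exact Continuous.integrableOn_Icc (by fun_prop)
    · intro x hx
      refine mul_le_mul_of_nonneg_right ?_ (by positivity)
      have h3 := half_le_norm_sum_expChar K (x - (ξ + δ / 2)) ?_
      · have := pow_le_pow_left₀ (by positivity) h3 2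
        linarith
      · intro k hk
        have hk' : (k : ℝ) ≤ 1 / (3 * δ) := le_trans (by exact_mod_cast (by omega)) hK2
        have hu : |x - (ξ + δ / 2)| ≤ δ / 2 := by
          rw [abs_le]; constructor <;> linarith [hx.1, hx.2]
        calc (k : ℝ) * |x - (ξ + δ / 2)| ≤ 1 / (3 * δ) * (δ / 2) :=
              mul_le_mul hk' hu (abs_nonneg _) (by positivity)
          _ = 1 / 6 := by field_simp; norm_num
    · exact Continuous.integrableOn_Icc (by fun_prop)
    · exact Filter.Eventually.of_forall fun x => by positivity
    · exact (Set.Icc_subset_Icc_right (by linarith)).eventuallyLE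
  rw [integral_const_mul] at h2
  rw [intervalIntegral.integral_of_le (by linarith), ← integral_Icc_eq_integral_Ioc] at h1
  have h4 := h2.trans h1
  have hA : 0 ≤ autoCorrSum N y (K - 1) := Finset.sum_nonneg fun _ _ => norm_nonneg _
  have h5 : ∫ x in Set.Icc ξ (ξ + δ), ‖quadSum N x y‖ ^ 2 ≤ 4 / K * autoCorrSum N y (K - 1) := by
    rw [div_mul_eq_mul_div, le_div_iff₀ hKr]
    have : (K : ℝ) / 4 * ∫ x in Set.Icc ξ (ξ + δ), ‖quadSum N x y‖ ^ 2 ≤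
        autoCorrSum N y (K - 1) := by
      refine le_of_mul_le_mul_left ?_ hKr
      linarith
    linarith
  refine h5.trans (mul_le_mul_of_nonneg_right ?_ hA)
  rw [div_le_iff₀ hKr]
  have := (div_le_iff₀ (by positivity)).1 hK1
  linarith

/-! ### Sums controlled by distances to the nearest integer -/

theorem sum_Icc_one_div_le (n : ℕ) : ∑ k ∈ Finset.Icc 1 n, (1 : ℝ) / k ≤ 1 + Real.log n := by
  have h := harmonic_le_one_add_log n
  simp only [harmonic_eq_sum_Icc, Rat.cast_sum, Rat.cast_inv, Rat.cast_natCast] at h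
  simpa only [one_div] using h

/-- As $a$ is invertible modulo $q$, the residue of $ha$ determines $h$ modulo $q$. -/
theorem card_filter_mul_emod_le (H q : ℕ) (hq : 0 < q) (a : ℤ) (ha : IsCoprime a (q : ℤ)) (r : ℕ) :
    (((Finset.Icc 1 H).filter fun h : ℕ => ((h * a) % (q : ℤ)).toNat = r).card : ℝ) ≤
      H / q + 1 := by
  rcases ((Finset.Icc 1 H).filter fun h : ℕ => ((h * a) % (q : ℤ)).toNat = r).eq_empty_or_nonempty
    with he | ⟨v, hv⟩
  · rw [he]; simp; positivity
  · have hsub : ((Finset.Icc 1 H).filter fun h : ℕ => ((h * a) % (q : ℤ)).toNat = r) ⊆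
        (Finset.Ioc 0 H).filter fun h : ℕ => h ≡ v [MOD q] := by
      intro h hh
      simp only [Finset.mem_filter, Finset.mem_Icc, Finset.mem_Ioc] at hh hv ⊢
      refine ⟨by omega, ?_⟩
      have hq0 : (q : ℤ) ≠ 0 := by exact_mod_cast hq.ne'
      have h1 : (h * a) % (q : ℤ) = (v * a) % (q : ℤ) := by
        have := Int.emod_nonneg (h * a) hq0
        have := Int.emod_nonneg (v * a) hq0
        omega
      have h2 : (q : ℤ) ∣ ((h : ℤ) - v) * a := by
        rw [sub_mul]; exact Int.ModEq.dvd (Int.ModEq.symm h1)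
      have h3 : (q : ℤ) ∣ (h : ℤ) - v := ha.symm.dvd_of_dvd_mul_right h2
      exact ((Nat.modEq_iff_dvd).2 h3).symm
    have hcard : ((((Finset.Ioc 0 H).filter fun h : ℕ => h ≡ v [MOD q]).card : ℤ) : ℚ) ≤
        H / q + 1 := by
      rw [Nat.Ioc_filter_modEq_card _ _ hq]
      rw [Int.cast_max, max_le_iff]
      constructor
      · push_cast
        have h1 := Int.floor_le (((H : ℚ) - v) / q)
        have h2 := Int.lt_floor_add_one (((0 : ℚ) - v) / q)
        rw [sub_div] at h1 h2
        rw [sub_div, sub_div]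
        linarith [zero_div (q : ℚ)]
      · push_cast; positivity
    have h4 : (((Finset.Ioc 0 H).filter fun h : ℕ => h ≡ v [MOD q]).card : ℝ) ≤ H / q + 1 := by
      have h5 := (Rat.cast_le (K := ℝ)).2 hcard
      push_cast at h5
      exact h5
    exact le_trans (by exact_mod_cast Finset.card_le_card hsub) h4

/-- Replacing $q\alpha$ by $a$ costs at most $h|q\alpha-a|\le1/2$, which is at most half of a
nonzero integer. -/
theorem half_abs_le_mul_abs_sub {N q h : ℕ} {a m : ℤ} {α : ℝ} (hN : 0 < N)
    (hα : |q * α - a| ≤ 1 / (2 * N)) (hh : h ≤ N) (hz : (h * a - q * m : ℤ) ≠ 0) :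
    |((h * a - q * m : ℤ) : ℝ)| / 2 ≤ q * |h * α - m| := by
  have hN' : (0 : ℝ) < N := by exact_mod_cast hN
  have h1 : (1 : ℝ) ≤ |((h * a - q * m : ℤ) : ℝ)| := by
    exact_mod_cast Int.one_le_abs hz
  have h2 : (h : ℝ) * |q * α - a| ≤ 1 / 2 := by
    calc (h : ℝ) * |q * α - a| ≤ N * (1 / (2 * N)) :=
          mul_le_mul (by exact_mod_cast hh) hα (abs_nonneg _) hN'.le
      _ = 1 / 2 := by field_simp
  have h3 : ((h * a - q * m : ℤ) : ℝ) = q * (h * α - m) - h * (q * α - a) := by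
    push_cast; ring
  have h4 := abs_sub (q * (h * α - m)) (h * (q * α - a))
  rw [← h3, abs_mul, abs_mul, Nat.abs_cast, Nat.abs_cast] at h4
  linarith

/-- With $m$ the integer nearest to $h\alpha$, the integer $ha-qm$ is congruent to $r\not\equiv0$
modulo $q$. Its modulus is therefore at least $r$ or at least $q-r$, according to its sign. -/
theorem le_two_mul_one_div_emod {N q h : ℕ} {a : ℤ} {α g : ℝ} (hN : 0 < N) (hq : 0 < q)
    (ha : IsCoprime a (q : ℤ)) (hα : |q * α - a| ≤ 1 / (2 * N)) (hh : h ≤ N) (hqh : ¬ q ∣ h)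
    (hg0 : 0 ≤ g) (hg : g * |h * α - round (h * α)| ≤ 1) :
    ((h * a) % (q : ℤ)).toNat ∈ Finset.Ico 1 q ∧
    g ≤ 2 * q * (1 / (((h * a) % (q : ℤ)).toNat : ℝ) +
      1 / ((q - ((h * a) % (q : ℤ)).toNat : ℕ) : ℝ)) := by
  have hqz : (0 : ℤ) < q := by exact_mod_cast hq
  have hqr : (0 : ℝ) < q := by exact_mod_cast hq
  set m := round (h * α)
  have hr0 := Int.emod_nonneg (h * a) hqz.ne'
  have hrq := Int.emod_lt_of_pos (h * a) hqz
  have hrne : (h * a) % (q : ℤ) ≠ 0 := by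
    intro h0
    apply hqh
    have := ha.symm.dvd_of_dvd_mul_right (Int.dvd_of_emod_eq_zero h0)
    exact_mod_cast this
  have hdm := Int.mul_ediv_add_emod (h * a) q
  obtain ⟨r, hr⟩ : ∃ r : ℕ, (h * a) % (q : ℤ) = r := ⟨_, (Int.toNat_of_nonneg hr0).symm⟩
  rw [hr] at hr0 hrq hrne hdm ⊢
  rw [Int.toNat_natCast]
  have hr1 : 1 ≤ r := by omega
  have hr2 : r < q := by omega
  refine ⟨by simp; omega, ?_⟩
  obtain ⟨t, ht⟩ : ∃ t : ℤ, h * a - q * m = q * t + r := ⟨(h * a) / q - m, by linarith⟩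
  have hz : (h * a - q * m : ℤ) ≠ 0 := by
    rw [ht]
    intro h0
    have : (q : ℤ) ∣ r := ⟨-t, by linarith⟩
    have := Int.le_of_dvd (by omega) this
    omega
  have hlow := half_abs_le_mul_abs_sub hN hα hh hz
  have hzabs : (1 : ℝ) / |((h * a - q * m : ℤ) : ℝ)| ≤ 1 / r + 1 / (q - r : ℕ) := by
    have hrr : (0 : ℝ) < r := by exact_mod_cast hr1
    have hqrr : (0 : ℝ) < (q - r : ℕ) := by exact_mod_cast (by omega : 0 < q - r)
    rcases le_or_gt 0 t with h0 | h0
    · have : (r : ℝ) ≤ |((h * a - q * m : ℤ) : ℝ)| := by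
        refine le_trans ?_ (le_abs_self _)
        rw [ht]
        exact_mod_cast (by nlinarith : (r : ℤ) ≤ q * t + r)
      have := one_div_le_one_div_of_le hrr this
      have : 0 ≤ (1 : ℝ) / (q - r : ℕ) := by positivity
      linarith
    · have : ((q - r : ℕ) : ℝ) ≤ |((h * a - q * m : ℤ) : ℝ)| := by
        refine le_trans ?_ (neg_le_abs _)
        rw [ht]
        have h5 : ((q - r : ℕ) : ℤ) ≤ -(q * t + r) := by
          rw [Nat.cast_sub hr2.le]; nlinarith
        exact_mod_cast h5
      have := one_div_le_one_div_of_le hqrr this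
      have : 0 ≤ (1 : ℝ) / r := by positivity
      linarith
  have hzpos : 0 < |((h * a - q * m : ℤ) : ℝ)| := abs_pos.2 (by exact_mod_cast hz)
  have h6 : g * |((h * a - q * m : ℤ) : ℝ)| ≤ 2 * q := by
    calc g * |((h * a - q * m : ℤ) : ℝ)| ≤ g * (2 * (q * |h * α - m|)) :=
          mul_le_mul_of_nonneg_left (by linarith) hg0
      _ = 2 * q * (g * |h * α - m|) := by ring
      _ ≤ 2 * q * 1 := mul_le_mul_of_nonneg_left hg (by positivity)
      _ = 2 * q := mul_one _
  have h7 : g ≤ 2 * q * (1 / |((h * a - q * m : ℤ) : ℝ)|) := by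
    rw [mul_one_div, le_div_iff₀ hzpos]; exact h6
  exact h7.trans (mul_le_mul_of_nonneg_left hzabs (by positivity))

/-- Group the $h$ by the residue of $ha$: each nonzero residue occurs at most $H/q+1$ times, and the
residues contribute two harmonic sums. -/
theorem sum_not_dvd_le {N q H : ℕ} {a : ℤ} {α : ℝ} {g : ℕ → ℝ} (hN : 0 < N) (hq : 0 < q)
    (ha : IsCoprime a (q : ℤ)) (hα : |q * α - a| ≤ 1 / (2 * N)) (hH : H ≤ N)
    (hg0 : ∀ h, 0 ≤ g h) (hg : ∀ h, g h * |h * α - round (h * α)| ≤ 1) :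
    ∑ h ∈ Finset.Icc 1 H with ¬ q ∣ h, g h ≤ 4 * (H + q) * (1 + Real.log q) := by
  have hqr : (0 : ℝ) < q := by exact_mod_cast hq
  set φ : ℕ → ℝ := fun r => 2 * q * (1 / (r : ℝ) + 1 / ((q - r : ℕ) : ℝ)) with hφ
  have hφ0 : ∀ r, 0 ≤ φ r := fun r => by simp only [hφ]; positivity
  have key : ∀ h ∈ (Finset.Icc 1 H).filter (fun h => ¬ q ∣ h),
      ((h * a) % (q : ℤ)).toNat ∈ Finset.Ico 1 q ∧ g h ≤ φ ((h * a) % (q : ℤ)).toNat := by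
    intro h hh
    simp only [Finset.mem_filter, Finset.mem_Icc] at hh
    exact le_two_mul_one_div_emod hN hq ha hα (by omega) hh.2 (hg0 h) (hg h)
  have hsum1 : ∑ r ∈ Finset.Ico 1 q, (1 : ℝ) / r ≤ 1 + Real.log q := by
    refine le_trans (Finset.sum_le_sum_of_subset_of_nonneg ?_ fun _ _ _ => by positivity)
      (sum_Icc_one_div_le q)
    intro r hr; simp at hr ⊢; omega
  have hsum2 : ∑ r ∈ Finset.Ico 1 q, (1 : ℝ) / (q - r : ℕ) = ∑ r ∈ Finset.Ico 1 q, (1 : ℝ) / r := by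
    refine Finset.sum_nbij' (fun r => q - r) (fun r => q - r) ?_ ?_ ?_ ?_ ?_
    · intro r hr; simp at hr ⊢; omega
    · intro r hr; simp at hr ⊢; omega
    · intro r hr; simp at hr ⊢; omega
    · intro r hr; simp at hr ⊢; omega
    · intro r hr; rfl
  calc ∑ h ∈ Finset.Icc 1 H with ¬ q ∣ h, g h
      ≤ ∑ h ∈ Finset.Icc 1 H with ¬ q ∣ h, φ ((h * a) % (q : ℤ)).toNat :=
        Finset.sum_le_sum fun h hh => (key h hh).2
    _ = ∑ r ∈ Finset.Ico 1 q, ∑ h ∈ ((Finset.Icc 1 H).filter (fun h => ¬ q ∣ h)).filter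
          (fun h : ℕ => ((h * a) % (q : ℤ)).toNat = r), φ ((h * a) % (q : ℤ)).toNat :=
        (Finset.sum_fiberwise_of_maps_to (fun h hh => (key h hh).1) _).symm
    _ ≤ ∑ r ∈ Finset.Ico 1 q, (H / q + 1) * φ r := by
        refine Finset.sum_le_sum fun r _ => ?_
        rw [Finset.sum_congr rfl (g := fun _ => φ r)
          (fun h hh => by rw [(Finset.mem_filter.1 hh).2]), Finset.sum_const, nsmul_eq_mul]
        refine mul_le_mul_of_nonneg_right ?_ (hφ0 r)
        refine le_trans ?_ (card_filter_mul_emod_le H q hq a ha r)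
        exact_mod_cast Finset.card_le_card
          (Finset.filter_subset_filter _ (Finset.filter_subset _ _))
    _ = (H / q + 1) * (2 * q * (∑ r ∈ Finset.Ico 1 q, (1 : ℝ) / r + ∑ r ∈ Finset.Ico 1 q,
          (1 : ℝ) / (q - r : ℕ))) := by
        rw [← Finset.mul_sum, ← Finset.mul_sum, Finset.sum_add_distrib]
    _ ≤ (H / q + 1) * (2 * q * (2 * (1 + Real.log q))) := by
        rw [hsum2]
        refine mul_le_mul_of_nonneg_left (mul_le_mul_of_nonneg_left ?_ (by positivity))
          (by positivity)
        linarith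
    _ = 4 * (H + q) * (1 + Real.log q) := by field_simp; ring

theorem sum_dvd_eq (q H : ℕ) (hq : 0 < q) (g : ℕ → ℝ) :
    ∑ h ∈ Finset.Icc 1 H with q ∣ h, g h = ∑ k ∈ Finset.Icc 1 (H / q), g (q * k) := by
  refine Finset.sum_nbij' (fun h => h / q) (fun k => q * k) ?_ ?_ ?_ ?_ ?_
  · intro h hh
    simp only [Finset.mem_filter, Finset.mem_Icc] at hh ⊢
    exact ⟨Nat.div_pos (Nat.le_of_dvd hh.1.1 hh.2) hq, Nat.div_le_div_right hh.1.2⟩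
  · intro k hk
    simp only [Finset.mem_filter, Finset.mem_Icc] at hk ⊢
    refine ⟨⟨Nat.mul_pos hq hk.1, ?_⟩, dvd_mul_right _ _⟩
    exact (Nat.mul_le_mul_left q hk.2).trans (Nat.mul_div_le H q)
  · intro h hh
    exact Nat.mul_div_cancel' (Finset.mem_filter.1 hh).2
  · intro k _; exact Nat.mul_div_cancel_left k hq
  · intro h hh
    rw [Nat.mul_div_cancel' (Finset.mem_filter.1 hh).2]

theorem sum_dvd_le {q H : ℕ} (hq : 0 < q) {g : ℕ → ℝ} {M : ℝ} (hM : 0 ≤ M) (hg : ∀ h, g h ≤ M) :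
    ∑ h ∈ Finset.Icc 1 H with q ∣ h, g h ≤ M * (H / q) := by
  rw [sum_dvd_eq q H hq]
  refine (Finset.sum_le_sum fun k _ => hg (q * k)).trans ?_
  rw [Finset.sum_const, nsmul_eq_mul, mul_comm, Nat.card_Icc, Nat.add_sub_cancel]
  exact mul_le_mul_of_nonneg_left Nat.cast_div_le hM

/-- For $h=qk$ the integer $ka$ is within $k|q\alpha-a|\le1/2$ of $h\alpha$, so no integer is
closer. Hence $|q\alpha-a|\,g(qk)\le1/k$. -/
theorem mul_sum_dvd_le {N q : ℕ} {a : ℤ} {α : ℝ} {g : ℕ → ℝ} (hN : 0 < N) (hq : 0 < q)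
    (hα : |q * α - a| ≤ 1 / (2 * N)) (hg0 : ∀ h, 0 ≤ g h)
    (hg : ∀ h : ℕ, g h * |h * α - round (h * α)| ≤ 1) :
    |q * α - a| * ∑ h ∈ Finset.Icc 1 N with q ∣ h, g h ≤ 1 + Real.log N := by
  have hNr : (0 : ℝ) < N := by exact_mod_cast hN
  rw [sum_dvd_eq q N hq, Finset.mul_sum]
  have h1 : ∀ k ∈ Finset.Icc 1 (N / q), |q * α - a| * g (q * k) ≤ 1 / (k : ℝ) := by
    intro k hk
    have hk1 : (0 : ℝ) < k := by exact_mod_cast (Finset.mem_Icc.1 hk).1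
    have hkN : (k : ℝ) ≤ N := by
      exact_mod_cast (Finset.mem_Icc.1 hk).2.trans (Nat.div_le_self _ _)
    have h2 : (k : ℝ) * |q * α - a| ≤ 1 / 2 := by
      calc (k : ℝ) * |q * α - a| ≤ N * (1 / (2 * N)) := mul_le_mul hkN hα (abs_nonneg _) hNr.le
        _ = 1 / 2 := by field_simp
    have hgk := hg (q * k)
    set m := round (((q * k : ℕ) : ℝ) * α)
    have h3 : (k : ℝ) * |q * α - a| ≤ |((q * k : ℕ) : ℝ) * α - m| := by
      have h4 : (k : ℝ) * |q * α - a| = |k * (q * α - a)| := by rw [abs_mul, Nat.abs_cast]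
      by_cases hm : m = k * a
      · rw [h4, hm]
        apply le_of_eq; congr 1; push_cast; ring
      · have h5 : (1 : ℝ) ≤ |((m - k * a : ℤ) : ℝ)| := by
          exact_mod_cast Int.one_le_abs (sub_ne_zero.2 hm)
        have h6 := abs_sub (k * (q * α - a)) (((q * k : ℕ) : ℝ) * α - m)
        rw [← h4, show k * (q * α - a) - (((q * k : ℕ) : ℝ) * α - m) = ((m - k * a : ℤ) : ℝ) by
          push_cast; ring] at h6
        linarith
    rw [le_div_iff₀ hk1]
    calc |q * α - a| * g (q * k) * k = g (q * k) * (k * |q * α - a|) := by ring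
      _ ≤ g (q * k) * |((q * k : ℕ) : ℝ) * α - m| := mul_le_mul_of_nonneg_left h3 (hg0 _)
      _ ≤ 1 := hgk
  refine (Finset.sum_le_sum h1).trans ?_
  refine le_trans (Finset.sum_le_sum_of_subset_of_nonneg ?_ fun _ _ _ => by positivity)
      (sum_Icc_one_div_le N)
  exact Finset.Icc_subset_Icc_right (Nat.div_le_self _ _)

/-! ### Large values and rational approximation -/

theorem autoCorrSum_eq (N : ℕ) (y : ℝ) (H : ℕ) :
    autoCorrSum N y H = ‖autoCorr N y 0‖ +
      ∑ h ∈ Finset.Icc 1 H, (‖autoCorr N y h‖ + ‖autoCorr N y (-(h : ℤ))‖) := by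
  unfold autoCorrSum
  induction H with
  | zero => simp
  | succ n ih =>
    have : Finset.Icc (-((n + 1 : ℕ) : ℤ)) ((n + 1 : ℕ) : ℤ) =
        insert ((n + 1 : ℕ) : ℤ) (insert (-((n + 1 : ℕ) : ℤ)) (Finset.Icc (-(n : ℤ)) n)) := by
      ext j; simp; omega
    rw [this, Finset.sum_insert (by simp; omega), Finset.sum_insert (by simp), ih,
      Finset.sum_Icc_succ_top (by omega)]
    ring

/-- The bounds for `autoCorrSum` in terms of a rational approximation to `2y`. -/
theorem autoCorrSum_bounds {N q : ℕ} {a : ℤ} {y : ℝ} (hN : 0 < N) (hq : 0 < q) (hqN : q ≤ 2 * N)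
    (ha : IsCoprime a (q : ℤ)) (hα : |q * (2 * y) - a| ≤ 1 / (2 * N)) :
    (∀ H ≤ N, autoCorrSum N y H ≤
      N + 2 * N * (H / q) + 8 * (H + q) * (1 + Real.log N)) ∧
    |q * (2 * y) - a| * (autoCorrSum N y N - 25 * N * (1 + Real.log N)) ≤ 1 + Real.log N := by
  have hN1 : (1 : ℝ) ≤ N := by exact_mod_cast hN
  have hlogN : 0 ≤ Real.log N := Real.log_nonneg hN1
  have hqr : (0 : ℝ) < q := by exact_mod_cast hq
  have hqN' : (q : ℝ) ≤ 2 * N := by exact_mod_cast hqN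
  set g : ℕ → ℝ := fun h => ‖autoCorr N y h‖ + ‖autoCorr N y (-(h : ℤ))‖ with hgdef
  have hg0 : ∀ h, 0 ≤ g h := fun h => by positivity
  have hgN : ∀ h, g h ≤ 2 * N := fun h => by
    have h1 := norm_autoCorr_le N y h
    have h2 := norm_autoCorr_le N y (-(h : ℤ))
    simp only [hgdef]; linarith
  -- `round` is not odd at half-integers, so the symmetry is drawn from its minimality in both
  -- directions.
  have hneg : ∀ t : ℝ, |-t - round (-t)| = |t - round t| := by
    intro t
    apply le_antisymm
    · have := round_le (-t) (-round t)
      rw [Int.cast_neg, ← neg_sub', abs_neg] at this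
      exact this
    · have := round_le t (-round (-t))
      rw [Int.cast_neg, sub_neg_eq_add, ← abs_neg (t + _), neg_add, ← sub_eq_add_neg] at this
      exact this
  have hg : ∀ h : ℕ, g h * |h * (2 * y) - round (h * (2 * y))| ≤ 1 := by
    intro h
    have h1 := norm_autoCorr_mul_le N y h
    have h2 := norm_autoCorr_mul_le N y (-(h : ℤ))
    push_cast at h1 h2
    rw [neg_mul, hneg] at h2
    simp only [hgdef, add_mul]
    linarith
  have hlogq : 1 + Real.log q ≤ 2 * (1 + Real.log N) := by
    have h1 := Real.log_le_log hqr hqN'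
    rw [Real.log_mul (by norm_num) (by positivity)] at h1
    have := Real.log_two_lt_d9
    linarith
  have h0 := norm_autoCorr_le N y 0
  have hsplit : ∀ H, autoCorrSum N y H = ‖autoCorr N y 0‖ +
      (∑ h ∈ Finset.Icc 1 H with q ∣ h, g h + ∑ h ∈ Finset.Icc 1 H with ¬ q ∣ h, g h) := by
    intro H
    rw [autoCorrSum_eq, Finset.sum_filter_add_sum_filter_not]
  have hnd : ∀ H ≤ N, ∑ h ∈ Finset.Icc 1 H with ¬ q ∣ h, g h ≤
      8 * (H + q) * (1 + Real.log N) := by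
    intro H hH
    refine (sum_not_dvd_le hN hq ha hα hH hg0 hg).trans ?_
    calc 4 * ((H : ℝ) + q) * (1 + Real.log q) ≤ 4 * ((H : ℝ) + q) * (2 * (1 + Real.log N)) :=
          mul_le_mul_of_nonneg_left hlogq (by positivity)
      _ = _ := by ring
  constructor
  · intro H hH
    rw [hsplit]
    have h1 := hnd H hH
    have h2 := sum_dvd_le (H := H) hq (by positivity) hgN
    linarith
  -- The constant $25$ is $1$ for the zero frequency plus $24$ for the $h$ not divisible by $q$.
  -- Only the multiples of $q$ remain.
  · refine le_trans (mul_le_mul_of_nonneg_left ?_ (abs_nonneg _))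
      (mul_sum_dvd_le hN hq hα hg0 hg)
    rw [hsplit]
    have h1 := hnd N le_rfl
    have h3 : 8 * ((N : ℝ) + q) * (1 + Real.log N) ≤ 24 * N * (1 + Real.log N) :=
      mul_le_mul_of_nonneg_right (by linarith) (by positivity)
    have h4 : (N : ℝ) ≤ N * (1 + Real.log N) := by nlinarith
    linarith

/-- A large value of the quadratic Weyl sum forces a good rational approximation to `2y`. -/
theorem exists_approx_of_large {N : ℕ} (hN : 0 < N) {T x y : ℝ} (hT : 0 < T)
    (hNT : 50 * N * (1 + Real.log N) ≤ N ^ 2 / T ^ 2) (hS : N / T ≤ ‖quadSum N x y‖) :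
    ∃ (q : ℕ) (a : ℤ), 0 < q ∧ q ≤ 2 * N ∧ (q : ℝ) ≤ 4 * T ^ 2 ∧ IsCoprime a (q : ℤ) ∧
      |q * (2 * y) - a| ≤ 1 / (2 * N) ∧
      |q * (2 * y) - a| ≤ 2 * T ^ 2 * (1 + Real.log N) / N ^ 2 := by
  have hN1 : (1 : ℝ) ≤ N := by exact_mod_cast hN
  have hlogN : 0 ≤ Real.log N := Real.log_nonneg hN1
  -- Dirichlet's theorem with denominators up to $2N$ keeps $h|q\alpha-a|\le1/2$ for every $h\le N$.
  obtain ⟨r, hr, hrN⟩ := Real.exists_rat_abs_sub_le_and_den_le (2 * y) (n := 2 * N) (by omega)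
  have hq : 0 < r.den := r.den_pos
  have hqr : (0 : ℝ) < r.den := by exact_mod_cast hq
  have hcop : IsCoprime r.num (r.den : ℤ) := by
    rw [Int.isCoprime_iff_gcd_eq_one]; exact r.reduced
  have hα : |r.den * (2 * y) - r.num| ≤ 1 / (2 * N) := by
    have h1 : (r.den : ℝ) * (2 * y) - r.num = r.den * (2 * y - r) := by
      have : (r : ℝ) = r.num / r.den := Rat.cast_def r
      rw [this]; field_simp
    rw [h1, abs_mul, Nat.abs_cast]
    calc (r.den : ℝ) * |2 * y - r| ≤ r.den * (1 / (((2 * N : ℕ) + 1) * r.den)) :=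
          mul_le_mul_of_nonneg_left hr hqr.le
      _ = 1 / (2 * N + 1) := by push_cast; field_simp
      _ ≤ 1 / (2 * N) := one_div_le_one_div_of_le (by positivity) (by linarith)
  obtain ⟨h1, h2⟩ := autoCorrSum_bounds hN hq hrN hcop hα
  have h3 : (N : ℝ) ^ 2 / T ^ 2 ≤ autoCorrSum N y N := by
    rw [← div_pow]
    exact (pow_le_pow_left₀ (by positivity) hS 2).trans (sq_norm_quadSum_le N x y)
  refine ⟨r.den, r.num, hq, hrN, ?_, hcop, hα, ?_⟩
  · have h4 := h1 N le_rfl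
    have hqN' : (r.den : ℝ) ≤ 2 * N := by exact_mod_cast hrN
    have h5 : 8 * ((N : ℝ) + r.den) * (1 + Real.log N) ≤ 24 * N * (1 + Real.log N) :=
      mul_le_mul_of_nonneg_right (by linarith) (by positivity)
    have h6 : (N : ℝ) ≤ N * (1 + Real.log N) := by nlinarith
    -- By `hNT` the error $25N(1+\log N)$ is at most half of $N^2/T^2$, so the term $2N^2/q$ carries
    -- the other half.
    have h7 : (N : ℝ) ^ 2 / T ^ 2 ≤ 4 * N ^ 2 / r.den := by
      have : 2 * (N : ℝ) * (N / r.den) = 2 * N ^ 2 / r.den := by ring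
      have h8 : 4 * (N : ℝ) ^ 2 / r.den = 2 * (2 * N ^ 2 / r.den) := by ring
      linarith
    rw [div_le_div_iff₀ (by positivity) hqr] at h7
    have hN2 : (0 : ℝ) < (N : ℝ) ^ 2 := by positivity
    exact le_of_mul_le_mul_left (by linarith) hN2
  · have h4 : |r.den * (2 * y) - r.num| * (N ^ 2 / (2 * T ^ 2)) ≤ 1 + Real.log N := by
      refine le_trans (mul_le_mul_of_nonneg_left ?_ (abs_nonneg _)) h2
      have : (N : ℝ) ^ 2 / T ^ 2 = 2 * (N ^ 2 / (2 * T ^ 2)) := by field_simp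
      linarith
    rw [le_div_iff₀ (by positivity)]
    rw [mul_div_assoc', div_le_iff₀ (by positivity)] at h4
    linarith

/-! ### Measure of the set of large values -/

/-- Chebyshev's inequality for the local second moment. Since $\delta H\le1/3$, the multiples of $q$
contribute only about $N/q$, and everything else is $\ll\delta N(1+\log N)$. -/
theorem volume_large_section_le {N : ℕ} (hN : 0 < N) {T δ ξ y : ℝ} (hT : 0 < T) (hδ : 0 < δ)
    (hδ1 : δ ≤ 1) (hδN : 1 ≤ δ * N) {q : ℕ} {a : ℤ} (hq : 0 < q) (hqN : q ≤ 2 * N)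
    (ha : IsCoprime a (q : ℤ)) (hα : |q * (2 * y) - a| ≤ 1 / (2 * N)) :
    volume ({x | N / T ≤ ‖quadSum N x y‖} ∩ Set.Icc ξ (ξ + δ)) ≤
      ENNReal.ofReal (240 * T ^ 2 * (1 + Real.log N) / N * (δ + 1 / q)) := by
  have hN1 : (1 : ℝ) ≤ N := by exact_mod_cast hN
  have hlogN : 0 ≤ Real.log N := Real.log_nonneg hN1
  have hqr : (0 : ℝ) < q := by exact_mod_cast hq
  have hqN' : (q : ℝ) ≤ 2 * N := by exact_mod_cast hqN
  have hS := continuous_quadSum N y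
  obtain ⟨H, hH, hint⟩ := setIntegral_sq_norm_quadSum_le N ξ y δ hδ hδ1
  have hHδ : δ * H ≤ 1 / 3 := by
    calc δ * H ≤ δ * (1 / (3 * δ)) := mul_le_mul_of_nonneg_left hH hδ.le
      _ = 1 / 3 := by field_simp
  have hHN : H ≤ N := by
    have : (H : ℝ) ≤ N := by
      refine le_of_mul_le_mul_left (a := δ) ?_ hδ
      linarith
    exact_mod_cast this
  have hA := (autoCorrSum_bounds hN hq hqN ha hα).1 H hHN
  set L := 1 + Real.log N with hL
  have hL1 : 1 ≤ L := by linarith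
  have hbound : ∫ x in Set.Icc ξ (ξ + δ), ‖quadSum N x y‖ ^ 2 ≤ 240 * N * L * (δ + 1 / q) := by
    refine hint.trans ?_
    have h1 : 12 * δ * autoCorrSum N y H ≤
        12 * (δ * N + 2 * N / q * (δ * H) + 8 * (δ * H) * L + 8 * (δ * q) * L) := by
      calc 12 * δ * autoCorrSum N y H ≤
            12 * δ * (N + 2 * N * (H / q) + 8 * (H + q) * L) :=
            mul_le_mul_of_nonneg_left hA (by positivity)
        _ = _ := by ring
    have h2 : δ * N ≤ δ * N * L := le_mul_of_one_le_right (by positivity) hL1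
    have h3 : 2 * N / q * (δ * H) ≤ N / q * L := by
      have h31 : 2 * N / q * (δ * H) ≤ 2 * N / q * (1 / 3) :=
        mul_le_mul_of_nonneg_left hHδ (by positivity)
      have h32 : (N : ℝ) / q ≤ N / q * L := le_mul_of_one_le_right (by positivity) hL1
      have h33 : 2 * (N : ℝ) / q * (1 / 3) = N / q * (2 / 3) := by ring
      have : 0 ≤ (N : ℝ) / q := by positivity
      linarith
    have h4 : 8 * (δ * H) * L ≤ 3 * (δ * N) * L :=
      mul_le_mul_of_nonneg_right (by linarith) (by positivity)
    have h5 : 8 * (δ * q) * L ≤ 16 * (δ * N) * L := by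
      refine mul_le_mul_of_nonneg_right ?_ (by positivity)
      have := mul_le_mul_of_nonneg_left hqN' hδ.le
      linarith
    have h6 : 240 * N * L * (δ + 1 / q) = 240 * (δ * N * L) + 240 * (N / q * L) := by ring
    have h7 : 0 ≤ (N : ℝ) / q * L := by positivity
    rw [h6]
    nlinarith
  have hcheb := mul_meas_ge_le_integral_of_nonneg (μ := volume.restrict (Set.Icc ξ (ξ + δ)))
    (f := fun x => ‖quadSum N x y‖ ^ 2) (Filter.Eventually.of_forall fun x => by positivity)
    (Continuous.integrableOn_Icc (by fun_prop)) ((N / T) ^ 2)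
  have hset : {x | (N / T) ^ 2 ≤ ‖quadSum N x y‖ ^ 2} = {x | N / T ≤ ‖quadSum N x y‖} := by
    ext x
    exact pow_le_pow_iff_left₀ (by positivity) (norm_nonneg _) (by norm_num)
  rw [hset, measureReal_restrict_apply
    (isClosed_le continuous_const (by fun_prop)).measurableSet] at hcheb
  have hfin : volume ({x | N / T ≤ ‖quadSum N x y‖} ∩ Set.Icc ξ (ξ + δ)) ≠ ⊤ :=
    ((measure_mono Set.inter_subset_right).trans_lt isCompact_Icc.measure_lt_top).ne
  rw [← ENNReal.ofReal_toReal hfin]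
  refine ENNReal.ofReal_le_ofReal ?_
  rw [← measureReal_def]
  have h8 := hcheb.trans hbound
  have hpos : (0 : ℝ) < (N / T) ^ 2 := by positivity
  refine le_of_mul_le_mul_left (h8.trans (le_of_eq ?_)) hpos
  field_simp

/-- At most $2q\delta+2$ numerators $a$ are relevant, and each gives an interval of length $\eta/q$.
-/
theorem volume_near_rational_le {q : ℕ} (hq : 0 < q) {δ ξ η : ℝ} (hδ : 0 < δ)
    (hη : 0 ≤ η) (hη2 : η ≤ 1 / 2) :
    volume {y | y ∈ Set.Icc ξ (ξ + δ) ∧ ∃ a : ℤ, |q * (2 * y) - a| ≤ η} ≤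
      ENNReal.ofReal (2 * η * (δ + 1 / q)) := by
  have hqr : (0 : ℝ) < q := by exact_mod_cast hq
  set A := Finset.Icc ⌈2 * q * ξ - η⌉ ⌊2 * q * (ξ + δ) + η⌋
  have hsub : {y | y ∈ Set.Icc ξ (ξ + δ) ∧ ∃ a : ℤ, |q * (2 * y) - a| ≤ η} ⊆
      ⋃ a ∈ A, Set.Icc ((a - η) / (2 * q)) ((a + η) / (2 * q)) := by
    rintro y ⟨⟨hy1, hy2⟩, a, hya⟩
    rw [abs_le] at hya
    have h1 : 2 * q * ξ ≤ 2 * q * y := mul_le_mul_of_nonneg_left hy1 (by positivity)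
    have h2 : 2 * q * y ≤ 2 * q * (ξ + δ) := mul_le_mul_of_nonneg_left hy2 (by positivity)
    simp only [Set.mem_iUnion, A, Finset.mem_Icc, Int.ceil_le, Int.le_floor, exists_prop]
    refine ⟨a, ⟨by linarith [hya.1, hya.2], by linarith [hya.1, hya.2]⟩, ?_, ?_⟩
    · rw [div_le_iff₀ (by positivity)]; linarith [hya.1, hya.2]
    · rw [le_div_iff₀ (by positivity)]; linarith [hya.1, hya.2]
  have hcard : (A.card : ℝ) ≤ 2 * q * δ + 2 := by
    have h0 : (0 : ℝ) ≤ 2 * q * δ + 2 := by positivity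
    have h1 := Int.le_ceil (2 * q * ξ - η)
    have h2 := Int.floor_le (2 * q * (ξ + δ) + η)
    simp only [A, Int.card_Icc]
    have h3 : (((⌊2 * q * (ξ + δ) + η⌋ + 1 - ⌈2 * q * ξ - η⌉).toNat : ℤ) : ℝ) ≤
        2 * q * δ + 2 := by
      rw [Int.toNat_eq_max, Int.cast_max, max_le_iff]
      push_cast
      exact ⟨by linarith, h0⟩
    exact_mod_cast h3
  refine (measure_mono hsub).trans ((measure_biUnion_finset_le _ _).trans ?_)
  have hlen : ∀ a : ℤ, volume (Set.Icc (((a : ℝ) - η) / (2 * q)) ((a + η) / (2 * q))) =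
      ENNReal.ofReal (η / q) := by
    intro a
    rw [Real.volume_Icc]; congr 1; field_simp; ring
  simp only [hlen, Finset.sum_const, nsmul_eq_mul]
  rw [← ENNReal.ofReal_natCast, ← ENNReal.ofReal_mul (by positivity)]
  refine ENNReal.ofReal_le_ofReal ?_
  calc (A.card : ℝ) * (η / q) ≤ (2 * q * δ + 2) * (η / q) :=
        mul_le_mul_of_nonneg_right hcard (by positivity)
    _ = 2 * η * (δ + 1 / q) := by field_simp

theorem sum_Icc_one_div_sq_le (n : ℕ) : ∑ k ∈ Finset.Icc 1 n, (1 / (k : ℝ)) ^ 2 ≤ 2 := by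
  have key : ∀ n : ℕ, ∑ k ∈ Finset.Icc 1 (n + 1), (1 / (k : ℝ)) ^ 2 ≤
      2 - 1 / ((n : ℝ) + 1) := by
    intro n
    induction n with
    | zero => norm_num
    | succ n ih =>
      rw [Finset.sum_Icc_succ_top (by omega)]
      have h1 : (1 / (((n + 1 + 1 : ℕ) : ℝ))) ^ 2 ≤ 1 / (n + 1) - 1 / ((n + 1 : ℕ) + 1) := by
        push_cast
        rw [div_sub_div _ _ (by positivity) (by positivity), div_pow,
          div_le_div_iff₀ (by positivity) (by positivity)]
        nlinarith [(Nat.cast_nonneg n : (0 : ℝ) ≤ n)]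
      linarith
  cases n with
  | zero => simp
  | succ n =>
    have h1 := key n
    have : (0 : ℝ) ≤ 1 / (n + 1) := by positivity
    linarith

theorem continuous_quadSum_uncurry (N : ℕ) : Continuous fun p : ℝ × ℝ => quadSum N p.1 p.2 := by
  unfold quadSum
  have := continuous_expChar
  fun_prop

/-- The measure of the set of large values of the quadratic Weyl sum in a small box. -/
theorem volume_large_values_le {N : ℕ} (hN : 0 < N) {T δ ξ ζ : ℝ} (hT : 0 < T) (hδ : 0 < δ)
    (hδ1 : δ ≤ 1) (hδN : 1 ≤ δ * N) (hδT : 1 ≤ δ * T)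
    (hNT : 50 * N * (1 + Real.log N) ≤ N ^ 2 / T ^ 2) :
    (volume.prod volume) {p : ℝ × ℝ | p.1 ∈ Set.Icc ξ (ξ + δ) ∧ p.2 ∈ Set.Icc ζ (ζ + δ) ∧
      N / T ≤ ‖quadSum N p.1 p.2‖} ≤
      ENNReal.ofReal (11520 * δ ^ 2 * (1 + Real.log N) ^ 2 * T ^ 6 / N ^ 3) := by
  have hN1 : (1 : ℝ) ≤ N := by exact_mod_cast hN
  have hlogN : 0 ≤ Real.log N := Real.log_nonneg hN1
  have hSc := continuous_quadSum_uncurry N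
  set L := 1 + Real.log N with hL
  have hL1 : 1 ≤ L := by linarith
  set E := {p : ℝ × ℝ | p.1 ∈ Set.Icc ξ (ξ + δ) ∧ p.2 ∈ Set.Icc ζ (ζ + δ) ∧
      N / T ≤ ‖quadSum N p.1 p.2‖} with hE
  have hEm : MeasurableSet E := by
    refine (measurableSet_Icc.preimage measurable_fst).inter
      ((measurableSet_Icc.preimage measurable_snd).inter ?_)
    exact (isClosed_le continuous_const hSc.norm).measurableSet
  set η := 2 * T ^ 2 * L / N ^ 2 with hη
  have hη0 : 0 ≤ η := by positivity
  have hη2 : η ≤ 1 / 2 := by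
    rw [hη, div_le_iff₀ (by positivity)]
    rw [le_div_iff₀ (by positivity)] at hNT
    have h1 : T ^ 2 * L ≤ N * L * T ^ 2 := by
      have : 0 ≤ T ^ 2 * L := by positivity
      nlinarith
    nlinarith
  set Q := ⌊4 * T ^ 2⌋₊ with hQ
  have hQT : (Q : ℝ) ≤ 4 * T ^ 2 := Nat.floor_le (by positivity)
  set Y : ℕ → Set ℝ := fun q => {y | y ∈ Set.Icc ζ (ζ + δ) ∧ ∃ a : ℤ, |q * (2 * y) - a| ≤ η}
    with hY
  have hYm : ∀ q, MeasurableSet (Y q) := by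
    intro q
    refine measurableSet_Icc.inter ?_
    have : {y : ℝ | ∃ a : ℤ, |q * (2 * y) - a| ≤ η} =
        ⋃ a : ℤ, {y : ℝ | |q * (2 * y) - a| ≤ η} := by ext; simp
    change MeasurableSet {y : ℝ | ∃ a : ℤ, |q * (2 * y) - a| ≤ η}
    rw [this]
    exact MeasurableSet.iUnion fun a =>
      (isClosed_le (by fun_prop) continuous_const).measurableSet
  set B : ℕ → ℝ := fun q => 240 * T ^ 2 * L / N * (δ + 1 / q) with hB
  -- A nonempty section supplies one admissible $q$, and the sum over all $q\le Q$ dominates its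
  -- term.
  have hsec : ∀ y, volume ((fun x => (x, y)) ⁻¹' E) ≤
      ∑ q ∈ Finset.Icc 1 Q, (Y q).indicator (fun _ => ENNReal.ofReal (B q)) y := by
    intro y
    rcases ((fun x => (x, y)) ⁻¹' E).eq_empty_or_nonempty with he | ⟨x, hx⟩
    · rw [he]; simp
    · obtain ⟨q, a, hq, hqN, hqT, hcop, hα, hαη⟩ := exists_approx_of_large hN hT hNT hx.2.2
      have hqm : q ∈ Finset.Icc 1 Q := Finset.mem_Icc.2 ⟨hq, Nat.le_floor hqT⟩
      have hyq : y ∈ Y q := ⟨hx.2.1, a, hαη⟩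
      refine le_trans ?_ (Finset.single_le_sum
        (f := fun q => (Y q).indicator (fun _ => ENNReal.ofReal (B q)) y)
        (fun _ _ => zero_le) hqm)
      simp only [Set.indicator_of_mem hyq]
      refine le_trans (measure_mono ?_)
        (volume_large_section_le (ξ := ξ) hN hT hδ hδ1 hδN hq hqN hcop hα)
      intro x' hx'
      exact ⟨hx'.2.2, hx'.1⟩
  rw [Measure.prod_apply_symm hEm]
  refine (lintegral_mono hsec).trans ?_
  rw [lintegral_finsetSum _ fun q _ => measurable_const.indicator (hYm q)]
  have hterm : ∀ q ∈ Finset.Icc 1 Q,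
      ∫⁻ y, (Y q).indicator (fun _ => ENNReal.ofReal (B q)) y ≤
        ENNReal.ofReal (960 * T ^ 4 * L ^ 2 / N ^ 3 * (2 * δ ^ 2 + 2 * (1 / (q : ℝ)) ^ 2)) := by
    intro q hq
    have hq0 : 0 < q := (Finset.mem_Icc.1 hq).1
    have hqr : (0 : ℝ) < q := by exact_mod_cast hq0
    rw [lintegral_indicator_const (hYm q)]
    refine (mul_le_mul_right (volume_near_rational_le hq0 hδ hη0 hη2) _).trans ?_
    rw [← ENNReal.ofReal_mul (by positivity)]
    refine ENNReal.ofReal_le_ofReal ?_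
    have h1 : B q * (2 * η * (δ + 1 / q)) =
        960 * T ^ 4 * L ^ 2 / N ^ 3 * (δ + 1 / q) ^ 2 := by
      simp only [hB, hη]; field_simp; ring
    rw [h1]
    refine mul_le_mul_of_nonneg_left ?_ (by positivity)
    nlinarith [sq_nonneg (δ - 1 / q)]
  refine (Finset.sum_le_sum hterm).trans ?_
  rw [← ENNReal.ofReal_sum_of_nonneg fun q _ => by positivity]
  refine ENNReal.ofReal_le_ofReal ?_
  rw [← Finset.mul_sum, Finset.sum_add_distrib, Finset.sum_const, Nat.card_Icc,
    Nat.add_sub_cancel, nsmul_eq_mul, ← Finset.mul_sum]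
  have h1 := sum_Icc_one_div_sq_le Q
  have h2 : (Q : ℝ) * (2 * δ ^ 2) ≤ 4 * T ^ 2 * (2 * δ ^ 2) :=
    mul_le_mul_of_nonneg_right hQT (by positivity)
  -- This absorbs the convergent sum of $1/q^2$: $8(\delta T)^2+4\le12(\delta T)^2$.
  have h3 : 1 ≤ (δ * T) ^ 2 := one_le_pow₀ hδT
  calc 960 * T ^ 4 * L ^ 2 / N ^ 3 *
        (Q * (2 * δ ^ 2) + 2 * ∑ k ∈ Finset.Icc 1 Q, (1 / (k : ℝ)) ^ 2)
      ≤ 960 * T ^ 4 * L ^ 2 / N ^ 3 * (12 * (δ * T) ^ 2) := by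
        refine mul_le_mul_of_nonneg_left ?_ (by positivity)
        linarith [mul_pow δ T 2]
    _ = 11520 * δ ^ 2 * L ^ 2 * T ^ 6 / N ^ 3 := by ring

/-! ### Level-set splitting and choice of the threshold -/

theorem boxMeanValue_two_le {N : ℕ} (hN : 0 < N) {s T δ : ℝ} (hs : 0 < s) (ξ : Fin 2 → ℝ)
    (hT : 0 < T) (hδ : 0 < δ) (hδ1 : δ ≤ 1) (hδN : 1 ≤ δ * N) (hδT : 1 ≤ δ * T)
    (hNT : 50 * N * (1 + Real.log N) ≤ N ^ 2 / T ^ 2) :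
    boxMeanValue s 2 δ ξ 1 N ≤ δ ^ 2 * (N / T) ^ (2 * s) +
      N ^ (2 * s) * (11520 * δ ^ 2 * (1 + Real.log N) ^ 2 * T ^ 6 / N ^ 3) := by
  have hN1 : (1 : ℝ) ≤ N := by exact_mod_cast hN
  have hc := continuous_weylSum 2 1 N
  set F := {x : Fin 2 → ℝ | N / T ≤ ‖weylSum 2 x 1 N‖} with hF
  have hFm : MeasurableSet F := (isClosed_le continuous_const (by fun_prop)).measurableSet
  have hfin : volume (weylBox 2 δ ξ) ≠ ⊤ := isCompact_Icc.measure_lt_top.ne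
  have hv : volume.real (weylBox 2 δ ξ) = δ ^ 2 := by
    rw [weylBox, measureReal_def, Real.volume_Icc_pi_toReal (fun j => by simpa using hδ.le)]
    simp
  have hvF : volume.real (F ∩ weylBox 2 δ ξ) ≤
      11520 * δ ^ 2 * (1 + Real.log N) ^ 2 * T ^ 6 / N ^ 3 := by
    have hpre : F ∩ weylBox 2 δ ξ = (MeasurableEquiv.finTwoArrow : (Fin 2 → ℝ) ≃ᵐ ℝ × ℝ) ⁻¹'
        {p : ℝ × ℝ | p.1 ∈ Set.Icc (ξ 0) (ξ 0 + δ) ∧ p.2 ∈ Set.Icc (ξ 1) (ξ 1 + δ) ∧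
          N / T ≤ ‖quadSum N p.1 p.2‖} := by
      ext x
      simp only [hF, weylBox, Set.mem_inter_iff, Set.mem_ofPred_eq, Set.mem_Icc, Pi.le_def,
        Fin.forall_fin_two, weylSum_two_eq_quadSum, Set.mem_preimage,
        MeasurableEquiv.finTwoArrow_apply]
      tauto
    rw [measureReal_def, hpre, (volume_preserving_finTwoArrow ℝ).measure_preimage_equiv]
    refine ENNReal.toReal_le_of_le_ofReal (by positivity) ?_
    exact volume_large_values_le hN hT hδ hδ1 hδN hδT hNT
  have hpt : ∀ x, ‖weylSum 2 x 1 N‖ ^ (2 * s) ≤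
      (N / T) ^ (2 * s) + F.indicator (fun _ => (N : ℝ) ^ (2 * s)) x := by
    intro x
    by_cases hx : x ∈ F
    · rw [Set.indicator_of_mem hx]
      have h1 := Real.rpow_le_rpow (norm_nonneg _) (norm_weylSum_one_le 2 x N)
        (by positivity : 0 ≤ 2 * s)
      have : 0 ≤ ((N : ℝ) / T) ^ (2 * s) := by positivity
      linarith
    · rw [Set.indicator_of_notMem hx, add_zero]
      exact Real.rpow_le_rpow (norm_nonneg _) (not_le.1 hx).le (by positivity)
  have hi1 : IntegrableOn (fun _ : Fin 2 → ℝ => ((N : ℝ) / T) ^ (2 * s)) (weylBox 2 δ ξ) :=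
    integrableOn_const hfin
  have hi2 : IntegrableOn (F.indicator fun _ : Fin 2 → ℝ => (N : ℝ) ^ (2 * s)) (weylBox 2 δ ξ) :=
    (integrableOn_const hfin).indicator hFm
  calc boxMeanValue s 2 δ ξ 1 N
      ≤ ∫ x in weylBox 2 δ ξ, ((N / T) ^ (2 * s) + F.indicator (fun _ => (N : ℝ) ^ (2 * s)) x) :=
        setIntegral_mono (integrableOn_weylBox hs 2 δ ξ 1 N) (hi1.add hi2) hpt
    _ = δ ^ 2 * (N / T) ^ (2 * s) + N ^ (2 * s) * volume.real (F ∩ weylBox 2 δ ξ) := by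
        rw [integral_add hi1 hi2, setIntegral_const, hv, smul_eq_mul, integral_indicator_const _ hFm,
          measureReal_restrict_apply hFm, smul_eq_mul, mul_comm (volume.real _)]
    _ ≤ _ := by
        gcongr

theorem eventually_mul_one_add_log_le (C κ : ℝ) (hκ : 0 < κ) :
    ∀ᶠ N : ℕ in Filter.atTop, C * (1 + Real.log N) ≤ (N : ℝ) ^ κ := by
  have h1 : (fun x : ℝ => C * (1 + Real.log x)) =o[Filter.atTop] fun x => x ^ κ := by
    refine Asymptotics.IsLittleO.const_mul_left (Asymptotics.IsLittleO.add ?_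
      (isLittleO_log_rpow_atTop hκ)) _
    refine Asymptotics.isLittleO_const_left.2 (Or.inr ?_)
    exact tendsto_norm_atTop_atTop.comp (tendsto_rpow_atTop hκ)
  have h2 := tendsto_natCast_atTop_atTop.eventually (h1.bound one_pos)
  filter_upwards [h2] with N hN
  rw [one_mul, Real.norm_of_nonneg (Real.rpow_nonneg (Nat.cast_nonneg N) κ)] at hN
  exact (le_abs_self _).trans hN

theorem theorem3p7 (s : ℝ) (hs : 0 < s) (ε : ℝ) (hε : 0 < ε) :
    ∃ N₀ : ℕ, ∀ N : ℕ, N₀ ≤ N → ∀ δ : ℝ, (N : ℝ) ^ (-(3 / (6 + 2 * s))) ≤ δ → δ ≤ 1 →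
      supBoxMeanValue s 2 δ N ≤
        δ ^ 2 * (N : ℝ) ^ (2 * s * (1 - 3 / (6 + 2 * s)) + ε) := by
  set θ := 3 / (6 + 2 * s) with hθ
  have hθ0 : 0 < θ := by positivity
  -- Here $s>0$ gives $\theta<1/2$, so $N^2/T^2$ exceeds $N$ by a positive power, which beats the
  -- logarithm.
  have hθ2 : 0 < 1 - 2 * θ := by
    rw [hθ, sub_pos, mul_div_assoc', div_lt_one (by positivity)]; linarith
  have hθs : 6 * θ + 2 * s * θ = 3 := by rw [hθ]; field_simp
  -- The constant $108$ is chosen because $108^2=11664\ge11520+1$, so squaring absorbs both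
  -- contributions into $N^{\varepsilon}$.
  obtain ⟨N₀, hN₀⟩ := Filter.eventually_atTop.1
    ((eventually_mul_one_add_log_le 50 (1 - 2 * θ) hθ2).and
      ((eventually_mul_one_add_log_le 108 (ε / 2) (by positivity)).and
        (Filter.eventually_gt_atTop 0)))
  refine ⟨N₀, fun N hN δ hδ hδ1 => ?_⟩
  obtain ⟨hlog1, hlog2, hN0⟩ := hN₀ N hN
  have hN1 : (1 : ℝ) ≤ N := by exact_mod_cast hN0
  have hNr : (0 : ℝ) < N := by linarith
  have hlogN : 0 ≤ Real.log N := Real.log_nonneg hN1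
  set T := (N : ℝ) ^ θ with hTdef
  have hT : 0 < T := by positivity
  have hδ0 : 0 < δ := lt_of_lt_of_le (by positivity) hδ
  have hδT : 1 ≤ δ * T := by
    have h1 := mul_le_mul_of_nonneg_right hδ hT.le
    rwa [hTdef, ← Real.rpow_add hNr, neg_add_cancel, Real.rpow_zero] at h1
  have hTN : T ≤ N := by
    rw [hTdef]
    exact (Real.rpow_le_rpow_of_exponent_le hN1 (by linarith)).trans_eq (Real.rpow_one _)
  have hδN : 1 ≤ δ * N := hδT.trans (mul_le_mul_of_nonneg_left hTN hδ0.le)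
  have hNT : 50 * N * (1 + Real.log N) ≤ N ^ 2 / T ^ 2 := by
    have h1 : (N : ℝ) ^ 2 / T ^ 2 = N * N ^ (1 - 2 * θ) := by
      rw [hTdef, ← Real.rpow_natCast ((N : ℝ) ^ θ), ← Real.rpow_mul hNr.le,
        ← Real.rpow_natCast (N : ℝ), ← Real.rpow_sub hNr, ← Real.rpow_one_add' hNr.le (by linarith)]
      congr 1; push_cast; ring
    rw [h1]
    linarith [mul_le_mul_of_nonneg_left hlog1 hNr.le]
  have hne : Nonempty (unitTorusCube 2) := ⟨⟨0, fun j => by simp⟩⟩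
  refine ciSup_le fun ξ => ?_
  refine (boxMeanValue_two_le hN0 hs ξ hT hδ0 hδ1 hδN hδT hNT).trans ?_
  have h1 : ((N : ℝ) / T) ^ (2 * s) = N ^ (2 * s * (1 - θ)) := by
    rw [hTdef]
    nth_rewrite 1 [← Real.rpow_one (N : ℝ)]
    rw [← Real.rpow_sub hNr, ← Real.rpow_mul hNr.le]
    congr 1; ring
  have h2 : (N : ℝ) ^ (2 * s) * (T ^ 6 / N ^ 3) = N ^ (2 * s * (1 - θ)) := by
    rw [hTdef, ← Real.rpow_natCast ((N : ℝ) ^ θ), ← Real.rpow_mul hNr.le,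
      ← Real.rpow_natCast (N : ℝ), ← Real.rpow_sub hNr, ← Real.rpow_add hNr]
    congr 1; push_cast; linarith
  have h3 : 1 + 11520 * (1 + Real.log N) ^ 2 ≤ (N : ℝ) ^ ε := by
    have h4 := pow_le_pow_left₀ (by positivity) hlog2 2
    rw [← Real.rpow_natCast ((N : ℝ) ^ (ε / 2)), ← Real.rpow_mul hNr.le] at h4
    rw [show ε / 2 * ((2 : ℕ) : ℝ) = ε by push_cast; ring] at h4
    nlinarith
  rw [Real.rpow_add hNr, h1]
  calc δ ^ 2 * (N : ℝ) ^ (2 * s * (1 - θ)) +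
        N ^ (2 * s) * (11520 * δ ^ 2 * (1 + Real.log N) ^ 2 * T ^ 6 / N ^ 3)
      = δ ^ 2 * (N : ℝ) ^ (2 * s * (1 - θ)) +
        11520 * δ ^ 2 * (1 + Real.log N) ^ 2 * (N ^ (2 * s) * (T ^ 6 / N ^ 3)) := by ring
    _ = δ ^ 2 * ((N : ℝ) ^ (2 * s * (1 - θ)) * (1 + 11520 * (1 + Real.log N) ^ 2)) := by
        rw [h2]; ring
    _ ≤ _ := by gcongr
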